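/- **Theorem 2 (Formula for the average consumed fidelity).** Consider a 1G$n$B entanglement buffer, with $n\ge 1$ short-lived memories, generation probability $p_{\mathrm{gen}}\in(0,1]$, consumption probability $p_{\mathrm{con}}\in(0,1]$, purification probability $q\in[0,1]$, decoherence rate $\Gamma\ge 0$, fidelity of new links $F_{\mathrm{new}}\in(1/4,1]$, and a purification policy with real coefficients $a_k,b_k,c_k,d_k$ ($1\le k\le n$). Put $p_k(F)=c_k(F-\frac14)+d_k$ and $J_k(F)=\frac14+\frac{a_k(F-1/4)+b_k}{c_k(F-1/4)+d_k}$, and assume that $0\le p_k(F)\le 1$ and $0\le a_k(F-\frac14)+b_k\le\frac34\,p_k(F)$ for all $F\in[\frac14,1]$ (so that $p_k$ is a probability and the output fidelity $J_k$ lies in $[\frac14,1]$). Let $F(t)$, $t=0,1,2,\dots$, be the fidelity of the buffered link, with $F(t)=0$ if there is none; the initial value $F(0)$ is $0$ or any number in $[\frac14,1]$ (for example $F(0)=F_{\mathrm{new}}$). For $t\ge1$ let $F^-(t)=e^{-\Gamma}(F(t-1)-\frac14)+\frac14$ if $F(t-1)>0$, and $F^-(t)=0$ otherwise. Independently in each time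 step from $t-1$ to $t$, a consumption request arrives with probability $p_{\mathrm{con}}$ (its arrival time is $t$), each of the $n$ generation attempts succeeds with probability $p_{\mathrm{gen}}$, and the system decides in favour of purification with probability $q$, all independently of each other. Let $k$ be the number of successful attempts. - If $F(t-1)=0$, then $F(t)=F_{\mathrm{new}}$ if $k\ge1$, and $F(t)=0$ if $k=0$ (whether or not a request arrives). - If $F(t-1)>0$ and a request arrives, the link is consumed, with fidelity $F^-(t)$, and $F(t)=0$. - If $F(t-1)>0$, no request arrives, $k\ge1$ and the system decides to purify, then $F(t)=J_k(F^-(t))$ with probability $p_k(F^-(t))$, and $F(t)=0$ otherwise. - In the remaining cases $F(t)=F^-(t)$. Let $T^{(j)}_{\mathrm{con}}$ be the arrival time of the $j$-th consumption request and let $$\overline F=\lim_{m\to\infty}\frac{\sum_{j=1}^m \mathbb 1\{F^-(T^{(j)}_{\mathrm{con}})>0\}\,F^-(T^{(j)}_{\mathrm{con}})}{\sum_{j=1}^m \mathbb 1\{F^-(T^{(j)}_{\mathrm{con}})>0\}}$$ be the average consumed fidelity. Then almost surely there are infinitely many requests, the denominators are nonzero for all large $m$, the limit exists, and $$\overline F=\frac{\tilde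 w F_{\mathrm{new}}+\tilde x}{\tilde y F_{\mathrm{new}}+\tilde z},$$ where $\tilde y F_{\mathrm{new}}+\tilde z\neq0$ and $$\tilde w=p_{\mathrm{con}}+q(1-p_{\mathrm{con}})\big(p^*_{\mathrm{gen}}+\tfrac14\tilde c-\tilde d\big),\qquad \tilde x=\tfrac14\Big[e^\Gamma-1+q(1-p_{\mathrm{con}})\big(-\tilde a+4\tilde b-\tfrac14\tilde c+\tilde d\big)\Big],$$ $$\tilde y=q(1-p_{\mathrm{con}})\tilde c,\qquad \tilde z=e^\Gamma-1+p_{\mathrm{con}}+q(1-p_{\mathrm{con}})\big(p^*_{\mathrm{gen}}-\tilde a-\tfrac14\tilde c\big),$$ with $p^*_{\mathrm{gen}}=1-(1-p_{\mathrm{gen}})^n$ and $\tilde v=\sum_{k=1}^n v_k\binom nk(1-p_{\mathrm{gen}})^{n-k}p_{\mathrm{gen}}^k$ for $v\in\{a,b,c,d\}$. -/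

import Mathlib

open MeasureTheory ProbabilityTheory Filter Topology

noncomputable section

namespace GnB

/-- The parameters of a 1GnB entanglement buffer. The purification policy enters through the
coefficients `a k, b k, c k, d k` of the protocol used when `k` new links are generated;
only the indices `1 ≤ k ≤ n` are ever used. -/
structure Buffer where
  /-- number of short-lived (B) memories -/
  n : ℕ
  /-- success probability of one entanglement generation attempt in one B memory -/
  pgen : unitInterval
  /-- probability that a consumption request arrives in a time step -/
  pcon : unitInterval
  /-- probability of attempting purification after a successful generation -/
  q : unitInterval
  /-- rate of decoherence -/
  Γ : ℝ
  /-- fidelity of newly generated links -/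
  Fnew : ℝ
  a : ℕ → ℝ
  b : ℕ → ℝ
  c : ℕ → ℝ
  d : ℕ → ℝ

namespace Buffer

variable (S : Buffer)

/-- Fidelity after one time step of depolarising noise. -/
def decay (F : ℝ) : ℝ := (F - 1 / 4) * Real.exp (-S.Γ) + 1 / 4

/-- Success probability of the protocol used with `k` new links, on a buffered link of
fidelity `F`. -/
def succProb (k : ℕ) (F : ℝ) : ℝ := S.c k * (F - 1 / 4) + S.d k

/-- Jump function: output fidelity of the protocol used with `k` new links when it succeeds. -/
def jump (k : ℕ) (F : ℝ) : ℝ :=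
  1 / 4 + (S.a k * (F - 1 / 4) + S.b k) / (S.c k * (F - 1 / 4) + S.d k)

/-- The ranges of the parameters. The last two fields say that, on every Werner state
(fidelity in `[1/4, 1]`), the success probability is a probability and the output fidelity lies
in `[1/4, 1]`; the latter is written without division, so that a protocol which never succeeds
(`c k = d k = 0`) has `a k = b k = 0`. -/
structure Admissible : Prop where
  n_pos : 1 ≤ S.n
  pgen_pos : 0 < (S.pgen : ℝ)
  pcon_pos : 0 < (S.pcon : ℝ)
  Γ_nonneg : 0 ≤ S.Γ
  Fnew_gt : 1 / 4 < S.Fnew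
  Fnew_le : S.Fnew ≤ 1
  succProb_mem : ∀ k, 1 ≤ k → k ≤ S.n → ∀ F : ℝ, 1 / 4 ≤ F → F ≤ 1 →
    0 ≤ S.succProb k F ∧ S.succProb k F ≤ 1
  output_mem : ∀ k, 1 ≤ k → k ≤ S.n → ∀ F : ℝ, 1 / 4 ≤ F → F ≤ 1 →
    0 ≤ S.a k * (F - 1 / 4) + S.b k ∧
      S.a k * (F - 1 / 4) + S.b k ≤ 3 / 4 * S.succProb k F

/-- The random input of one time step of a buffer with `n` B memories: whether a consumption
request arrives; which of the `n` generation attempts succeed; whether the system decides to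
purify if it can; and a number which, being uniform on `[0, 1]`, makes an event of
probability `p` happen when it is smaller than `p`. -/
abbrev Input (n : ℕ) : Type := Bool × (Fin n → Bool) × Bool × ℝ

/-- The joint law of the input of one time step: all the components are independent. -/
def inputLaw : Measure (Input S.n) :=
  (bernoulliMeasure true false S.pcon).prod
    ((Measure.pi fun _ : Fin S.n => bernoulliMeasure true false S.pgen).prod
      ((bernoulliMeasure true false S.q).prod
        ((volume : Measure ℝ).restrict (Set.Icc 0 1))))

variable {S}

/-- A consumption request arrives. -/
def Input.request {n : ℕ} (x : Input n) : Prop := x.1 = true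

/-- The number of new links if generation is attempted. -/
def Input.links {n : ℕ} (x : Input n) : ℕ :=
  (Finset.univ.filter fun i => x.2.1 i = true).card

/-- The system decides to purify. -/
def Input.purify {n : ℕ} (x : Input n) : Prop := x.2.2.1 = true

/-- The uniform number that settles whether purification succeeds. -/
def Input.unif {n : ℕ} (x : Input n) : ℝ := x.2.2.2

variable (S)

open Classical in
/-- One time step. The state is the fidelity of the buffered link, and `0` if there is none. -/
def step (F : ℝ) (x : Input S.n) : ℝ :=
  if 0 < F then
    if x.request then 0
    else if 1 ≤ x.links ∧ x.purify then
      if x.unif < S.succProb x.links (S.decay F) then S.jump x.links (S.decay F) else 0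
    else S.decay F
  else if 1 ≤ x.links then S.Fnew else 0

/-- The fidelity process `F(t)` started from `f₀`; the input `x t` governs the passage from
time `t - 1` to time `t`, for `t ≥ 1` (`x 0` is not used). -/
def fidelity (f₀ : ℝ) (x : ℕ → Input S.n) : ℕ → ℝ
  | 0 => f₀
  | t + 1 => S.step (fidelity f₀ x t) (x (t + 1))

/-- `F⁻(t)`, for `t ≥ 1`: the fidelity at the end of the time step from `t - 1` to `t`. -/
def fidelityBefore (f₀ : ℝ) (x : ℕ → Input S.n) (t : ℕ) : ℝ :=
  if 0 < S.fidelity f₀ x (t - 1) then S.decay (S.fidelity f₀ x (t - 1)) else 0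

/-- A consumption request arrives at time `t`. -/
def RequestAt (x : ℕ → Input S.n) (t : ℕ) : Prop := 1 ≤ t ∧ (x t).request

/-- The arrival time of the `(j + 1)`-th consumption request. -/
def requestTime (x : ℕ → Input S.n) (j : ℕ) : ℕ := Nat.nth (S.RequestAt x) j

/-- The indicator that there is a link: `1` if the fidelity is positive and `0` otherwise. -/
def linkExists (F : ℝ) : ℝ := if 0 < F then 1 else 0

/-- The sum of the consumed fidelities over the first `m` requests. -/
def consumedSum (f₀ : ℝ) (x : ℕ → Input S.n) (m : ℕ) : ℝ :=
  ∑ j ∈ Finset.range m, linkExists (S.fidelityBefore f₀ x (S.requestTime x j)) *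
    S.fidelityBefore f₀ x (S.requestTime x j)

/-- The number of requests, among the first `m`, that find a link. -/
def servedCount (f₀ : ℝ) (x : ℕ → Input S.n) (m : ℕ) : ℝ :=
  ∑ j ∈ Finset.range m, linkExists (S.fidelityBefore f₀ x (S.requestTime x j))

/-- Along the input sequence `x`, the average consumed fidelity is well defined (there are
infinitely many requests, and eventually the quotients have a nonzero denominator) and it is
equal to `L`. -/
def IsAvgConsumedFidelity (f₀ : ℝ) (x : ℕ → Input S.n) (L : ℝ) : Prop :=
  {t | S.RequestAt x t}.Infinite ∧
  (∀ᶠ m in atTop, S.servedCount f₀ x m ≠ 0) ∧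
  Tendsto (fun m => S.consumedSum f₀ x m / S.servedCount f₀ x m) atTop (𝓝 L)

/-- The average of the coefficients `v 1, …, v n` against the binomial weights. -/
def avg (v : ℕ → ℝ) : ℝ :=
  ∑ k ∈ Finset.Icc 1 S.n,
    v k * (S.n.choose k : ℝ) * (1 - (S.pgen : ℝ)) ^ (S.n - k) * (S.pgen : ℝ) ^ k

/-- The effective generation probability. -/
def pgenStar : ℝ := 1 - (1 - (S.pgen : ℝ)) ^ S.n

def wCoef : ℝ :=
  S.pcon + S.q * (1 - S.pcon) * (S.pgenStar + 1 / 4 * S.avg S.c - S.avg S.d)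

def xCoef : ℝ :=
  1 / 4 * (Real.exp S.Γ - 1 +
    S.q * (1 - S.pcon) * (-S.avg S.a + 4 * S.avg S.b - 1 / 4 * S.avg S.c + S.avg S.d))

def yCoef : ℝ := S.q * (1 - S.pcon) * S.avg S.c

def zCoef : ℝ :=
  Real.exp S.Γ - 1 + S.pcon +
    S.q * (1 - S.pcon) * (S.pgenStar - S.avg S.a - 1 / 4 * S.avg S.c)

end Buffer

end GnB

end

/-! Only two observables of the state matter: `linkExists`, the indicator `u` of a link, and
`excess`, the value `v` of `F - 1/4` on links. The success probability `p_k` is affine in `F`, and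
so is `p_k * (J_k - 1/4)`, because the denominator of the jump function cancels. Decay is affine
too. Hence the conditional expectations of `u` and `v` after one step are affine in their current
values (`integral_linkExists_step`, `integral_excess_step`): the pair is closed under the dynamics,
although the fidelity itself ranges over a continuum.

No stationary law is needed. A strong law for bounded orthogonal variables, applied to the
differences between observables and their conditional expectations (`ae_tendsto_avg_sub_integral`),
and the telescoping of `u (t + 1) - u t` show that the time averages of `u` and `v` asymptotically
solve a 2×2 linear system. Its determinant is positive (`systemDet_pos`), so the averages converge
to the solution given by Cramer's rule.

The request at time `t + 1` is independent of the state at time `t`, so the same strong law shows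
that restricting the sums to request times multiplies both limits by `pcon`. The consumed fidelity
is `exp (-Γ) * v + u / 4`. In the ratio the factors `pcon`, `pgenStar` and the determinant cancel,
which leaves the formula. -/

namespace GnB

/-! ### Strong law for bounded orthogonal variables -/

/-- The ratio of consecutive squares is eventually below any `a > 1`. -/
theorem eventually_succ_sq_le_mul_sq {a : ℝ} (ha : 1 < a) :
    ∀ᶠ n : ℕ in atTop, (((n + 1 + 1) ^ 2 : ℕ) : ℝ) ≤ a * (((n + 1) ^ 2 : ℕ) : ℝ) := by
  obtain ⟨N, hN⟩ := exists_nat_gt (3 / (a - 1))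
  filter_upwards [eventually_ge_atTop N] with n hn
  have hn' : (N : ℝ) ≤ n := by exact_mod_cast hn
  have h1 : 3 < (a - 1) * n := by
    have := hN.trans_le hn'
    rwa [div_lt_iff₀ (by linarith), mul_comm] at this
  push_cast
  have h0 : (0 : ℝ) ≤ n := n.cast_nonneg
  nlinarith

/-- Averages of a bounded sequence converge to zero as soon as they do so along the squares. -/
theorem tendsto_avg_zero_of_tendsto_avg_sq {x : ℕ → ℝ} {C : ℝ} (hx : ∀ t, |x t| ≤ C)
    (h : Tendsto (fun n : ℕ => (∑ t ∈ Finset.range ((n + 1) ^ 2), x t) / ((n + 1) ^ 2 : ℕ))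
      atTop (𝓝 0)) :
    Tendsto (fun n : ℕ => (∑ t ∈ Finset.range n, x t) / n) atTop (𝓝 0) := by
  -- Adding the bound `C` makes the terms nonnegative; monotone partial sums can be interpolated
  -- between consecutive squares, whose ratio tends to 1.
  have hmono : Monotone fun n : ℕ => ∑ t ∈ Finset.range n, (x t + C) := by
    refine monotone_nat_of_le_succ fun n => ?_
    rw [Finset.sum_range_succ]
    linarith [(abs_le.1 (hx n)).1]
  have hshift : ∀ n : ℕ, 0 < n →
      (∑ t ∈ Finset.range n, (x t + C)) / n = (∑ t ∈ Finset.range n, x t) / n + C := by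
    intro n hn
    have : (n : ℝ) ≠ 0 := by positivity
    rw [Finset.sum_add_distrib, Finset.sum_const, Finset.card_range, nsmul_eq_mul]
    field_simp
  have key := tendsto_div_of_monotone_of_exists_subseq_tendsto_div _ C hmono fun a ha =>
    ⟨fun n => (n + 1) ^ 2, eventually_succ_sq_le_mul_sq ha,
      (tendsto_pow_atTop two_ne_zero).comp (tendsto_add_atTop_nat 1), by
        have := h.add_const C
        rw [zero_add] at this
        refine this.congr fun n => ?_
        rw [hshift _ (by positivity)]⟩
  have := key.sub_const C
  rw [sub_self] at this
  refine this.congr' ?_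
  filter_upwards [eventually_gt_atTop 0] with n hn
  rw [hshift n hn, add_sub_cancel_right]

variable {Ω : Type*} [MeasurableSpace Ω] {μ : Measure Ω} [IsProbabilityMeasure μ]

theorem integrable_of_abs_le {f : Ω → ℝ} {C : ℝ} (hf : Measurable f) (hC : ∀ ω, |f ω| ≤ C) :
    Integrable f μ :=
  .of_bound hf.aestronglyMeasurable C (.of_forall hC)

/-- A strong law of large numbers for bounded variables, each of which is orthogonal to the sum of
the previous ones. -/
theorem ae_tendsto_avg_zero_of_orthogonal {ξ : ℕ → Ω → ℝ} {C : ℝ} (hm : ∀ t, Measurable (ξ t))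
    (hC : ∀ t ω, |ξ t ω| ≤ C)
    (horth : ∀ N, ∫ ω, (∑ t ∈ Finset.range N, ξ t ω) * ξ N ω ∂μ = 0) :
    ∀ᵐ ω ∂μ, Tendsto (fun n : ℕ => (∑ t ∈ Finset.range n, ξ t ω) / n) atTop (𝓝 0) := by
  set s : ℕ → Ω → ℝ := fun N ω => ∑ t ∈ Finset.range N, ξ t ω with hs
  have hsm : ∀ N, Measurable (s N) := fun N => Finset.measurable_sum _ fun t _ => hm t
  have hsb : ∀ N ω, |s N ω| ≤ N * C := fun N ω => by
    refine (Finset.abs_sum_le_sum_abs _ _).trans ?_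
    refine (Finset.sum_le_sum fun t _ => hC t ω).trans ?_
    simp
  have hint : ∀ {f g : Ω → ℝ} {A B : ℝ}, Measurable f → Measurable g → (∀ ω, |f ω| ≤ A) →
      (∀ ω, |g ω| ≤ B) → Integrable (fun ω => f ω * g ω) μ := by
    intro f g A B hf hg hA hB
    refine integrable_of_abs_le (C := A * B) (hf.mul hg) fun ω => ?_
    rw [abs_mul]
    exact mul_le_mul (hA ω) (hB ω) (abs_nonneg _) ((abs_nonneg _).trans (hA ω))
  -- Orthogonality kills the cross term, so the second moment of the sum grows only linearly.
  have hvar : ∀ N, ∫ ω, s N ω * s N ω ∂μ ≤ N * (C * C) := by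
    intro N
    induction N with
    | zero => simp [hs]
    | succ N ih =>
      have hexp : ∀ ω, s (N + 1) ω * s (N + 1) ω
          = s N ω * s N ω + (2 * (s N ω * ξ N ω) + ξ N ω * ξ N ω) := by
        intro ω
        simp only [hs, Finset.sum_range_succ]
        ring
      have i1 := hint (hsm N) (hsm N) (hsb N) (hsb N)
      have i2 := hint (hsm N) (hm N) (hsb N) (hC N)
      have i3 := hint (hm N) (hm N) (hC N) (hC N)
      simp_rw [hexp]
      have i4 : Integrable (fun ω => 2 * (s N ω * ξ N ω) + ξ N ω * ξ N ω) μ :=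
        (i2.const_mul 2).add i3
      rw [integral_add i1 i4, integral_add (i2.const_mul 2) i3,
        integral_const_mul, horth N]
      have hlast : ∫ ω, ξ N ω * ξ N ω ∂μ ≤ C * C := by
        have := integral_mono i3 (integrable_const (C * C)) fun ω => by
          change ξ N ω * ξ N ω ≤ C * C
          nlinarith [abs_le.1 (hC N ω)]
        simpa using this
      push_cast
      linarith
  -- Along the squares the second moments of the averages are at most `C² / (n + 1)²`, hence
  -- summable. So the squared averages are almost surely summable and tend to zero.
  set f : ℕ → Ω → ℝ := fun n ω => (s ((n + 1) ^ 2) ω / ((n + 1) ^ 2 : ℕ)) ^ 2 with hf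
  have hfm : ∀ n, Measurable (f n) := fun n => ((hsm _).div_const _).pow_const 2
  have hfi : ∀ n, ∫ ω, f n ω ∂μ ≤ C * C * (1 / ((n : ℝ) + 1) ^ 2) := by
    intro n
    have hpos : (0 : ℝ) < ((n : ℝ) + 1) ^ 2 := by positivity
    have h1 : ∀ ω, f n ω = (1 / (((n : ℝ) + 1) ^ 2) ^ 2) *
        (s ((n + 1) ^ 2) ω * s ((n + 1) ^ 2) ω) := by
      intro ω
      simp only [hf]
      push_cast
      field_simp
    simp_rw [h1]
    rw [integral_const_mul]
    have := hvar ((n + 1) ^ 2)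
    push_cast at this
    calc _ ≤ (1 / (((n : ℝ) + 1) ^ 2) ^ 2) * (((n : ℝ) + 1) ^ 2 * (C * C)) := by gcongr
      _ = _ := by field_simp
  have hsum : Summable fun n : ℕ => C * C * (1 / ((n : ℝ) + 1) ^ 2) := by
    have := (summable_nat_add_iff 1).2 (Real.summable_one_div_nat_pow.2 (by norm_num : 1 < 2))
    push_cast at this
    exact this.mul_left _
  have hfint : ∀ n, Integrable (f n) μ := fun n => by
    have := (hint (hsm ((n + 1) ^ 2)) (hsm ((n + 1) ^ 2)) (hsb _) (hsb _)).mul_const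
      (1 / (((n + 1) ^ 2 : ℕ) : ℝ) ^ 2)
    refine this.congr (.of_forall fun ω => ?_)
    simp only [hf]
    ring
  have hlt : ∑' n, ∫⁻ ω, ENNReal.ofReal (f n ω) ∂μ ≠ ⊤ := by
    refine ne_top_of_le_ne_top hsum.tsum_ofReal_ne_top (ENNReal.tsum_le_tsum fun n => ?_)
    rw [← ofReal_integral_eq_lintegral_ofReal (hfint n) (.of_forall fun ω => sq_nonneg _)]
    exact ENNReal.ofReal_le_ofReal (hfi n)
  rw [← lintegral_tsum fun n => (hfm n).ennreal_ofReal.aemeasurable] at hlt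
  filter_upwards [ae_lt_top (Measurable.tsum fun n => (hfm n).ennreal_ofReal) hlt]
    with ω hω
  refine tendsto_avg_zero_of_tendsto_avg_sq (hC · ω) ?_
  have h0 := ENNReal.tendsto_atTop_zero_of_tsum_ne_top hω.ne
  have h1 := (ENNReal.tendsto_toReal ENNReal.zero_ne_top).comp h0
  have h2 : Tendsto (fun n => f n ω) atTop (𝓝 0) := by
    refine h1.congr fun n => ?_
    exact ENNReal.toReal_ofReal (sq_nonneg _)
  have h3 := h2.sqrt
  rw [Real.sqrt_zero] at h3
  rw [tendsto_zero_iff_abs_tendsto_zero]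
  refine h3.congr fun n => ?_
  simp only [hf, Function.comp, Real.sqrt_sq_eq_abs, hs]

/-! ### Strong law for recursions driven by i.i.d. inputs -/

/-- A bounded function of two independent variables which is centred in the second one is
orthogonal to every bounded function of the first one. -/
theorem integral_mul_eq_zero_of_indepFun {E α : Type*} [MeasurableSpace E] [MeasurableSpace α]
    {Y : Ω → ℝ × E} {X : Ω → α} {ν : Measure α} [IsProbabilityMeasure ν]
    (hY : Measurable Y) (hX : Measurable X) (hind : IndepFun Y X μ) (hν : μ.map X = ν)
    {G : E × α → ℝ} (hG : Measurable G) {A C : ℝ} (hA : ∀ ω, |(Y ω).1| ≤ A)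
    (hC : ∀ z, |G z| ≤ C) (hcent : ∀ y, ∫ x, G (y, x) ∂ν = 0) :
    ∫ ω, (Y ω).1 * G ((Y ω).2, X ω) ∂μ = 0 := by
  have : IsProbabilityMeasure (μ.map Y) := Measure.isProbabilityMeasure_map hY.aemeasurable
  have hprod := (indepFun_iff_map_prod_eq_prod_map_map hY.aemeasurable hX.aemeasurable).1 hind
  rw [hν] at hprod
  have hm : Measurable fun z : (ℝ × E) × α => z.1.1 * G (z.1.2, z.2) := by fun_prop
  have h1 : ∫ ω, (Y ω).1 * G ((Y ω).2, X ω) ∂μ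
      = ∫ z, z.1.1 * G (z.1.2, z.2) ∂(μ.map fun ω => (Y ω, X ω)) := by
    rw [integral_map (hY.prodMk hX).aemeasurable hm.aestronglyMeasurable]
  have hae : ∀ᵐ y ∂(μ.map Y), |y.1| ≤ A := by
    rw [ae_map_iff hY.aemeasurable (measurableSet_le (by fun_prop) measurable_const)]
    exact .of_forall hA
  have hi : Integrable (fun z : (ℝ × E) × α => z.1.1 * G (z.1.2, z.2)) ((μ.map Y).prod ν) := by
    refine .of_bound hm.aestronglyMeasurable (A * C) ?_
    filter_upwards [Measure.quasiMeasurePreserving_fst.ae hae] with z hz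
    rw [Real.norm_eq_abs, abs_mul]
    exact mul_le_mul hz (hC _) (abs_nonneg _) ((abs_nonneg _).trans hz)
  rw [h1, hprod, integral_prod _ hi]
  simp_rw [integral_const_mul, hcent, mul_zero, integral_zero]

/-- **Ergodic averages of a random recursion.** Let `Z (t + 1) = φ (Z t, X (t + 1))` with i.i.d.
inputs `X`. Along almost every trajectory, the averages of a bounded `g (Z t, X (t + 1))` are
asymptotically those of its conditional expectation given `Z t`. -/
theorem ae_tendsto_avg_sub_integral {E α : Type*} [MeasurableSpace E] [MeasurableSpace α]
    {X : ℕ → Ω → α} {ν : Measure α} [IsProbabilityMeasure ν] (hX : ∀ t, Measurable (X t))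
    (hind : iIndepFun X μ) (hν : ∀ t, μ.map (X t) = ν) {Z : ℕ → Ω → E} {φ : E × α → E}
    (hφ : Measurable φ) (z₀ : E) (hZ0 : ∀ ω, Z 0 ω = z₀)
    (hZ : ∀ t ω, Z (t + 1) ω = φ (Z t ω, X (t + 1) ω)) {g : E × α → ℝ} (hg : Measurable g)
    {C : ℝ} (hC : ∀ z, |g z| ≤ C) :
    ∀ᵐ ω ∂μ, Tendsto (fun n : ℕ => (∑ t ∈ Finset.range n,
      (g (Z t ω, X (t + 1) ω) - ∫ x, g (Z t ω, x) ∂ν)) / n) atTop (𝓝 0) := by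
  set G : E × α → ℝ := fun z => g z - ∫ x, g (z.1, x) ∂ν with hGdef
  have hG : Measurable G := by
    refine hg.sub ?_
    have := (hg.stronglyMeasurable.integral_prod_right' (ν := ν)).measurable
    exact this.comp measurable_fst
  have hGC : ∀ z, |G z| ≤ C + C := fun z => by
    refine (norm_sub_le (g z) _).trans (add_le_add (hC z) ?_)
    have := norm_integral_le_of_norm_le_const (μ := ν) (f := fun x => g (z.1, x)) (C := C)
      (.of_forall fun x => hC _)
    simpa using this
  have hcent : ∀ y, ∫ x, G (y, x) ∂ν = 0 := fun y => by
    have hi : Integrable (fun x => g (y, x)) ν :=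
      integrable_of_abs_le (by fun_prop) fun x => hC _
    simp only [hGdef]
    rw [integral_sub hi (integrable_const _)]
    simp
  -- The state `Z t` and all earlier terms `ξ s`, `s < t`, are functions of the inputs up to time
  -- `t`, which are independent of `X (t + 1)`.
  set past : ℕ → MeasurableSpace Ω := fun t =>
    ⨆ k ∈ {k | k ≤ t}, MeasurableSpace.comap (X k) inferInstance with hpast
  have past_mono : Monotone past := fun s t hst => biSup_mono fun k hk => le_trans hk hst
  have hXpast : ∀ t, Measurable[past t] (X t) := fun t =>
    (comap_measurable (X t)).mono
      (le_iSup₂_of_le (f := fun k (_ : k ∈ {k | k ≤ t}) =>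
        MeasurableSpace.comap (X k) inferInstance) t (le_refl t) le_rfl) le_rfl
  have hZpast : ∀ t, Measurable[past t] (Z t) := by
    intro t
    induction t with
    | zero =>
      have : Z 0 = fun _ => z₀ := funext hZ0
      rw [this]
      exact @measurable_const _ _ _ (past 0) _
    | succ t ih =>
      have : Z (t + 1) = fun ω => φ (Z t ω, X (t + 1) ω) := funext (hZ t)
      rw [this]
      exact hφ.comp ((ih.mono (past_mono t.le_succ) le_rfl).prodMk (hXpast _))
  have hpast_le : ∀ t, past t ≤ ‹MeasurableSpace Ω› := fun t =>
    iSup₂_le fun k _ => (hX k).comap_le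
  have hZm : ∀ t, Measurable (Z t) := fun t => (hZpast t).mono (hpast_le t) le_rfl
  set ξ : ℕ → Ω → ℝ := fun t ω => G (Z t ω, X (t + 1) ω) with hξ
  have hξpast : ∀ t, Measurable[past (t + 1)] (ξ t) := fun t =>
    hG.comp (((hZpast t).mono (past_mono t.le_succ) le_rfl).prodMk (hXpast _))
  have hξm : ∀ t, Measurable (ξ t) := fun t => (hξpast t).mono (hpast_le _) le_rfl
  refine ae_tendsto_avg_zero_of_orthogonal (ξ := ξ) (C := C + C) hξm (fun t ω => hGC _) fun N => ?_
  set Y : Ω → ℝ × E := fun ω => (∑ t ∈ Finset.range N, ξ t ω, Z N ω) with hY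
  have hYpast : Measurable[past N] Y := by
    refine Measurable.prodMk ?_ (hZpast N)
    refine Finset.measurable_sum _ fun t ht => ?_
    exact (hξpast t).mono (past_mono (Finset.mem_range.1 ht)) le_rfl
  have hindY : IndepFun Y (X (N + 1)) μ := by
    have h1 : Indep (past N) (⨆ k ∈ ({N + 1} : Set ℕ), MeasurableSpace.comap (X k) inferInstance)
        μ := indep_iSup_of_disjoint (fun k => (hX k).comap_le) hind (by simp)
    rw [iSup_singleton] at h1
    exact (IndepFun_iff_Indep _ _ _).2 (indep_of_indep_of_le_left h1 hYpast.comap_le)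
  refine integral_mul_eq_zero_of_indepFun (Y := Y) (X := X (N + 1)) (hYpast.mono (hpast_le N) le_rfl)
    (hX _) hindY (hν _) hG (A := N * (C + C)) (fun ω => ?_) hGC hcent
  change |∑ t ∈ Finset.range N, ξ t ω| ≤ _
  refine (Finset.abs_sum_le_sum_abs _ _).trans ?_
  refine (Finset.sum_le_sum fun t _ => hGC _).trans ?_
  simp [mul_add]

/-! ### Integration against the law of one input -/

theorem integral_pi_bernoulli_card (n : ℕ) (p : unitInterval) (h : ℕ → ℝ) :
    ∫ y : Fin n → Bool, h (Finset.univ.filter fun i => y i = true).card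
      ∂(Measure.pi fun _ : Fin n => bernoulliMeasure true false p)
    = ∑ k ∈ Finset.range (n + 1),
        h k * (n.choose k : ℝ) * (1 - (p : ℝ)) ^ (n - k) * (p : ℝ) ^ k := by
  have hreal : ∀ y : Fin n → Bool,
      (Measure.pi fun _ : Fin n => bernoulliMeasure true false p).real {y}
      = (1 - (p : ℝ)) ^ (n - (Finset.univ.filter fun i => y i = true).card) *
        (p : ℝ) ^ (Finset.univ.filter fun i => y i = true).card := by
    intro y
    rw [measureReal_def, Measure.pi_singleton, ENNReal.toReal_prod]
    have h1 : ∀ i, ((bernoulliMeasure true false p) {y i}).toReal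
        = if y i = true then (p : ℝ) else 1 - p := by
      intro i
      rw [← measureReal_def]
      cases y i <;> simp
    simp_rw [h1]
    rw [Finset.prod_ite, Finset.prod_const, Finset.prod_const, mul_comm]
    congr 2
    have := Finset.card_filter_add_card_filter_not (s := Finset.univ) fun i => y i = true
    rw [Finset.card_univ, Fintype.card_fin] at this
    omega
  -- Identifying success patterns with subsets lets the sum be grouped by cardinality, which
  -- produces the binomial coefficients.
  let e : (Fin n → Bool) ≃ Finset (Fin n) :=
    { toFun := fun y => Finset.univ.filter fun i => y i = true
      invFun := fun s i => decide (i ∈ s)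
      left_inv := fun y => by ext i; simp
      right_inv := fun s => by ext i; simp }
  rw [integral_fintype .of_finite]
  simp_rw [hreal, smul_eq_mul]
  refine (Fintype.sum_equiv e _ (fun s : Finset (Fin n) =>
    (1 - (p : ℝ)) ^ (n - s.card) * (p : ℝ) ^ s.card * h s.card) fun y => rfl).trans ?_
  rw [← Finset.powerset_univ, Finset.sum_powerset_apply_card
      (fun k => (1 - (p : ℝ)) ^ (n - k) * (p : ℝ) ^ k * h k), Finset.card_univ, Fintype.card_fin]
  refine Finset.sum_congr rfl fun k _ => ?_
  rw [nsmul_eq_mul]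
  ring

theorem setIntegral_Icc_ite_lt {P : ℝ} (h0 : 0 ≤ P) (h1 : P ≤ 1) (c : ℝ) :
    ∫ r in Set.Icc (0 : ℝ) 1, (if r < P then c else 0) = P * c := by
  have h : ∀ r : ℝ, (if r < P then c else 0) = (Set.Iio P).indicator (fun _ => c) r := fun r => by
    simp [Set.indicator_apply]
  simp_rw [h]
  rw [setIntegral_indicator measurableSet_Iio, setIntegral_const]
  have : Set.Icc (0 : ℝ) 1 ∩ Set.Iio P = Set.Ico 0 P := by
    ext r
    simp only [Set.mem_inter_iff, Set.mem_Icc, Set.mem_Iio, Set.mem_Ico]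
    constructor
    · rintro ⟨⟨h, _⟩, h'⟩
      exact ⟨h, h'⟩
    · rintro ⟨h, h'⟩
      exact ⟨⟨h, h'.le.trans h1⟩, h'⟩
  rw [this]
  simp [measureReal_def, h0]

namespace Buffer

variable (S : Buffer)

instance isProbabilityMeasure_restrict_Icc :
    IsProbabilityMeasure ((volume : Measure ℝ).restrict (Set.Icc 0 1)) := ⟨by simp⟩

instance isProbabilityMeasure_inputLaw : IsProbabilityMeasure S.inputLaw := by
  unfold inputLaw
  infer_instance

theorem measurable_links {n : ℕ} : Measurable (Input.links : Input n → ℕ) :=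
  (Measurable.of_discrete (f := fun y : Fin n → Bool =>
    (Finset.univ.filter fun i => y i = true).card)).comp
    (by fun_prop : Measurable fun x : Input n => x.2.1)

theorem measurableSet_request {n : ℕ} : MeasurableSet {x : Input n | x.request} :=
  measurable_fst (measurableSet_singleton true)

theorem measurable_step : Measurable fun z : ℝ × Input S.n => S.step z.1 z.2 := by
  have hl : Measurable fun z : ℝ × Input S.n => z.2.links := measurable_links.comp measurable_snd
  have hd : Measurable fun z : ℝ × Input S.n => S.decay z.1 := by
    unfold decay
    fun_prop
  have hcoef : ∀ v : ℕ → ℝ, Measurable fun z : ℝ × Input S.n => v z.2.links := fun v =>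
    (measurable_from_top (f := v)).comp hl
  have ha := hcoef S.a
  have hb := hcoef S.b
  have hc := hcoef S.c
  have hdd := hcoef S.d
  have hs : Measurable fun z : ℝ × Input S.n => S.succProb z.2.links (S.decay z.1) := by
    unfold succProb
    fun_prop
  have hj : Measurable fun z : ℝ × Input S.n => S.jump z.2.links (S.decay z.1) := by
    unfold jump
    fun_prop
  have hu : Measurable fun z : ℝ × Input S.n => z.2.unif := by
    unfold Input.unif
    fun_prop
  have hl1 : MeasurableSet {z : ℝ × Input S.n | 1 ≤ z.2.links} := measurableSet_le measurable_const hl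
  have hp : MeasurableSet {z : ℝ × Input S.n | z.2.purify} :=
    (by fun_prop : Measurable fun z : ℝ × Input S.n => z.2.2.2.1) (measurableSet_singleton true)
  refine Measurable.ite (measurableSet_lt measurable_const measurable_fst) ?_ ?_
  · refine Measurable.ite (measurable_snd measurableSet_request) measurable_const ?_
    exact Measurable.ite (hl1.inter hp)
      (Measurable.ite (measurableSet_lt hu hs) hj measurable_const) hd
  · exact Measurable.ite hl1 measurable_const measurable_const

/-- Integration against the law of one input, one component at a time. -/
theorem integral_inputLaw {f : Input S.n → ℝ} (hf : Measurable f) {C : ℝ} (hC : ∀ x, |f x| ≤ C) :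
    ∫ x, f x ∂S.inputLaw =
      S.pcon * (∫ y, (S.q * (∫ r in Set.Icc (0 : ℝ) 1, f (true, y, true, r)) +
          (1 - S.q) * ∫ r in Set.Icc (0 : ℝ) 1, f (true, y, false, r))
        ∂(Measure.pi fun _ : Fin S.n => bernoulliMeasure true false S.pgen)) +
      (1 - S.pcon) * (∫ y, (S.q * (∫ r in Set.Icc (0 : ℝ) 1, f (false, y, true, r)) +
          (1 - S.q) * ∫ r in Set.Icc (0 : ℝ) 1, f (false, y, false, r))
        ∂(Measure.pi fun _ : Fin S.n => bernoulliMeasure true false S.pgen)) := by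
  have i1 : ∀ b, Integrable (fun w : (Fin S.n → Bool) × Bool × ℝ => f (b, w))
      ((Measure.pi fun _ : Fin S.n => bernoulliMeasure true false S.pgen).prod
      ((bernoulliMeasure true false S.q).prod
        ((volume : Measure ℝ).restrict (Set.Icc 0 1)))) := fun b =>
    integrable_of_abs_le (by fun_prop) fun _ => hC _
  have i2 : ∀ b y, Integrable (fun w : Bool × ℝ => f (b, y, w))
      ((bernoulliMeasure true false S.q).prod
        ((volume : Measure ℝ).restrict (Set.Icc 0 1))) := fun b y =>
    integrable_of_abs_le (by fun_prop) fun _ => hC _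
  have h2 : ∀ b y, ∫ w, f (b, y, w) ∂((bernoulliMeasure true false S.q).prod
        ((volume : Measure ℝ).restrict (Set.Icc 0 1)))
      = S.q * (∫ r in Set.Icc (0 : ℝ) 1, f (b, y, true, r)) +
          (1 - S.q) * ∫ r in Set.Icc (0 : ℝ) 1, f (b, y, false, r) := fun b y => by
    rw [integral_prod _ (i2 b y), integral_bernoulliMeasure]
    simp
  have h1 : ∀ b, ∫ w, f (b, w) ∂((Measure.pi fun _ : Fin S.n =>
        bernoulliMeasure true false S.pgen).prod ((bernoulliMeasure true false S.q).prod
        ((volume : Measure ℝ).restrict (Set.Icc 0 1))))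
      = ∫ y, (S.q * (∫ r in Set.Icc (0 : ℝ) 1, f (b, y, true, r)) +
          (1 - S.q) * ∫ r in Set.Icc (0 : ℝ) 1, f (b, y, false, r))
        ∂(Measure.pi fun _ : Fin S.n => bernoulliMeasure true false S.pgen) := fun b => by
    rw [integral_prod _ (i1 b)]
    simp_rw [h2]
  unfold inputLaw
  rw [integral_prod _ (integrable_of_abs_le hf hC), integral_bernoulliMeasure, h1, h1]
  simp

theorem integral_request (c : ℝ) :
    ∫ x, ({x : Input S.n | x.request}.indicator (fun _ => c) x) ∂S.inputLaw = S.pcon * c := by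
  rw [integral_inputLaw S (C := |c|) (measurable_const.indicator measurableSet_request)]
  · simp only [Set.indicator_apply, Set.mem_ofPred_eq, Input.request]
    simp [← add_mul]
  · intro x
    by_cases hx : x ∈ {x : Input S.n | x.request} <;> simp [hx]

/-- The probability of at least one new link, as a sum of binomial weights. -/
theorem sum_weights : ∑ k ∈ Finset.Icc 1 S.n,
    (S.n.choose k : ℝ) * (1 - (S.pgen : ℝ)) ^ (S.n - k) * (S.pgen : ℝ) ^ k = S.pgenStar := by
  have h := add_pow (S.pgen : ℝ) (1 - S.pgen) S.n
  rw [add_sub_cancel, one_pow, Finset.sum_range_eq_add_Ico _ (by omega)] at h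
  unfold pgenStar
  have h2 : Finset.Ico 1 (S.n + 1) = Finset.Icc 1 S.n := by ext; simp
  rw [h2] at h
  simp only [pow_zero, one_mul, Nat.sub_zero, Nat.choose_zero_right, Nat.cast_one, mul_one] at h
  rw [eq_sub_iff_add_eq']
  refine Eq.trans ?_ h.symm
  congr 1
  exact Finset.sum_congr rfl fun k _ => by ring

theorem avg_const (c : ℝ) : S.avg (fun _ => c) = c * S.pgenStar := by
  rw [← sum_weights, avg, Finset.mul_sum]
  exact Finset.sum_congr rfl fun k _ => by ring

theorem avg_add_mul (v w : ℕ → ℝ) (x : ℝ) :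
    S.avg (fun k => v k * x + w k) = S.avg v * x + S.avg w := by
  simp only [avg, Finset.sum_mul, ← Finset.sum_add_distrib]
  exact Finset.sum_congr rfl fun k _ => by ring

theorem avg_congr {v w : ℕ → ℝ} (h : ∀ k, 1 ≤ k → k ≤ S.n → v k = w k) : S.avg v = S.avg w :=
  Finset.sum_congr rfl fun k hk => by rw [h k (Finset.mem_Icc.1 hk).1 (Finset.mem_Icc.1 hk).2]

theorem avg_mono {v w : ℕ → ℝ} (h : ∀ k, 1 ≤ k → k ≤ S.n → v k ≤ w k) : S.avg v ≤ S.avg w := by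
  refine Finset.sum_le_sum fun k hk => ?_
  have h1 : (0 : ℝ) ≤ S.pgen := S.pgen.2.1
  have h2 : (0 : ℝ) ≤ 1 - S.pgen := sub_nonneg.2 S.pgen.2.2
  have := h k (Finset.mem_Icc.1 hk).1 (Finset.mem_Icc.1 hk).2
  gcongr

/-- The law of the number of new links. -/
theorem integral_links (h : ℕ → ℝ) :
    ∫ y : Fin S.n → Bool, h (Finset.univ.filter fun i => y i = true).card
      ∂(Measure.pi fun _ : Fin S.n => bernoulliMeasure true false S.pgen)
    = (1 - S.pgenStar) * h 0 + S.avg h := by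
  rw [integral_pi_bernoulli_card, Finset.sum_range_eq_add_Ico _ (by omega)]
  have h2 : Finset.Ico 1 (S.n + 1) = Finset.Icc 1 S.n := by ext; simp
  rw [h2, avg, pgenStar]
  simp [mul_comm]

/-! ### One step of the chain -/

/-- Fidelities that can occur. -/
def IsFidelity (F : ℝ) : Prop := F = 0 ∨ (1 / 4 ≤ F ∧ F ≤ 1)

variable {S}

theorem decay_mem (hS : S.Admissible) {F : ℝ} (h1 : 1 / 4 ≤ F) (h2 : F ≤ 1) :
    1 / 4 ≤ S.decay F ∧ S.decay F ≤ 1 := by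
  have he0 := Real.exp_pos (-S.Γ)
  have he1 : Real.exp (-S.Γ) ≤ 1 := Real.exp_le_one_iff.2 (by linarith [hS.Γ_nonneg])
  unfold decay
  constructor <;> nlinarith

theorem jump_mem (hS : S.Admissible) {k : ℕ} (hk1 : 1 ≤ k) (hkn : k ≤ S.n) {F : ℝ}
    (h1 : 1 / 4 ≤ F) (h2 : F ≤ 1) (hpos : 0 < S.succProb k F) :
    1 / 4 ≤ S.jump k F ∧ S.jump k F ≤ 1 := by
  obtain ⟨h3, h4⟩ := hS.output_mem k hk1 hkn F h1 h2
  have h5 := div_nonneg h3 hpos.le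
  have h6 := (div_le_iff₀ hpos).2 h4
  unfold succProb at h5 h6
  unfold jump
  constructor <;> linarith

theorem links_le {n : ℕ} (x : Input n) : x.links ≤ n :=
  (Finset.card_filter_le _ _).trans (Finset.card_fin n).le

/-- With `0 ≤ unif`, the test `unif < succProb` can succeed only if `succProb` is positive, so the
jump is never evaluated with a zero denominator. -/
theorem isFidelity_step (hS : S.Admissible) {F : ℝ} (hF : IsFidelity F) {x : Input S.n}
    (hx : 0 ≤ x.unif) : IsFidelity (S.step F x) := by
  unfold step
  split_ifs with h0 hr hk hu hl
  · exact .inl rfl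
  · have hF' : 1 / 4 ≤ F ∧ F ≤ 1 := hF.resolve_left h0.ne'
    obtain ⟨h1, h2⟩ := decay_mem hS hF'.1 hF'.2
    exact .inr (jump_mem hS hk.1 (links_le x) h1 h2 (hx.trans_lt hu))
  · exact .inl rfl
  · have hF' : 1 / 4 ≤ F ∧ F ≤ 1 := hF.resolve_left h0.ne'
    exact .inr (decay_mem hS hF'.1 hF'.2)
  · exact .inr ⟨hS.Fnew_gt.le, hS.Fnew_le⟩
  · exact .inl rfl

theorem integral_step_zero (S : Buffer) {φ : ℝ → ℝ} (hφ : Measurable φ) {C : ℝ}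
    (hC : ∀ F, |φ F| ≤ C) (hφ0 : φ 0 = 0) :
    ∫ x, φ (S.step 0 x) ∂S.inputLaw = S.pgenStar * φ S.Fnew := by
  have hm : Measurable fun x : Input S.n => φ (S.step 0 x) :=
    hφ.comp (S.measurable_step.comp measurable_prodMk_left)
  rw [integral_inputLaw S hm fun x => hC _]
  have h := S.integral_links fun k => if 1 ≤ k then φ S.Fnew else 0
  have h3 : S.avg (fun k => if 1 ≤ k then φ S.Fnew else 0) = φ S.Fnew * S.pgenStar := by
    rw [← avg_const]
    exact S.avg_congr fun k hk _ => by simp [hk]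
  rw [h3] at h
  have hstep : ∀ x : Input S.n, φ (S.step 0 x) =
      if 1 ≤ (Finset.univ.filter fun i => x.2.1 i = true).card then φ S.Fnew else 0 := by
    intro x
    unfold step Input.links
    rw [if_neg (lt_irrefl 0)]
    split_ifs <;> simp [hφ0]
  simp_rw [hstep]
  simp only [integral_const, probReal_univ, one_smul, ← add_mul, add_sub_cancel, one_mul]
  rw [h]
  simp [mul_comm]

/-- As `φ 0 = 0`, consumption and failed purification contribute nothing. Without a request,
purification is attempted with probability `q * pgenStar`; otherwise the link only decays. -/
theorem integral_step_pos (hS : S.Admissible) {F : ℝ} (h1 : 1 / 4 ≤ F) (h2 : F ≤ 1)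
    {φ : ℝ → ℝ} (hφ : Measurable φ) {C : ℝ} (hC : ∀ F, |φ F| ≤ C) (hφ0 : φ 0 = 0) :
    ∫ x, φ (S.step F x) ∂S.inputLaw =
      (1 - S.pcon) * ((1 - S.q * S.pgenStar) * φ (S.decay F) +
        S.q * S.avg fun k => S.succProb k (S.decay F) * φ (S.jump k (S.decay F))) := by
  have hF : 0 < F := by linarith
  obtain ⟨hd1, hd2⟩ := decay_mem hS h1 h2
  have hm : Measurable fun x : Input S.n => φ (S.step F x) :=
    hφ.comp (S.measurable_step.comp measurable_prodMk_left)
  have htrue : ∀ y c r, φ (S.step F (true, y, c, r)) = 0 := by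
    intro y c r
    simp [step, hF, Input.request, hφ0]
  have hff : ∀ y r, φ (S.step F (false, y, false, r)) = φ (S.decay F) := by
    intro y r
    simp [step, hF, Input.request, Input.purify]
  have hft : ∀ y, ∫ r in Set.Icc (0 : ℝ) 1, φ (S.step F (false, y, true, r)) =
      (fun k => if 1 ≤ k then S.succProb k (S.decay F) * φ (S.jump k (S.decay F))
        else φ (S.decay F)) (Finset.univ.filter fun i => y i = true).card := by
    intro y
    set k := (Finset.univ.filter fun i => y i = true).card with hk
    have hkn : k ≤ S.n := links_le (n := S.n) (false, y, true, 0)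
    by_cases hk1 : 1 ≤ k
    · have hval : ∀ r, φ (S.step F (false, y, true, r)) =
          if r < S.succProb k (S.decay F) then φ (S.jump k (S.decay F)) else 0 := by
        intro r
        have hstep : S.step F (false, y, true, r) =
            if r < S.succProb k (S.decay F) then S.jump k (S.decay F) else 0 := by
          unfold step
          rw [if_pos hF, if_neg (by simp [Input.request]), if_pos ⟨hk1, by simp [Input.purify]⟩]
          rfl
        rw [hstep]
        split_ifs
        exacts [rfl, hφ0]
      obtain ⟨hp0, hp1⟩ := hS.succProb_mem k hk1 hkn _ hd1 hd2
      simp_rw [hval]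
      rw [setIntegral_Icc_ite_lt hp0 hp1]
      simp [hk1]
    · have hval : ∀ r, φ (S.step F (false, y, true, r)) = φ (S.decay F) := by
        intro r
        congr 1
        unfold step
        rw [if_pos hF, if_neg (by simp [Input.request]), if_neg fun h => hk1 h.1]
      simp_rw [hval]
      simp [hk1]
  rw [integral_inputLaw S hm fun x => hC _]
  simp_rw [htrue, hft, hff]
  have hlinks := S.integral_links fun k =>
    S.q * (if 1 ≤ k then S.succProb k (S.decay F) * φ (S.jump k (S.decay F))
        else φ (S.decay F)) + (1 - S.q) * φ (S.decay F)
  have havg : S.avg (fun k => S.q * (if 1 ≤ k then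
        S.succProb k (S.decay F) * φ (S.jump k (S.decay F)) else φ (S.decay F)) +
        (1 - S.q) * φ (S.decay F))
      = S.avg (fun k => S.succProb k (S.decay F) * φ (S.jump k (S.decay F))) * S.q +
        (1 - S.q) * φ (S.decay F) * S.pgenStar := by
    rw [← avg_const, ← avg_add_mul]
    exact S.avg_congr fun k hk _ => by simp [hk, mul_comm]
  rw [havg] at hlinks
  simp only [integral_const, probReal_univ, one_smul, mul_zero, add_zero, zero_add] at hlinks ⊢
  rw [hlinks]
  simp only [nonpos_iff_eq_zero, one_ne_zero, if_false]
  ring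

/-! ### The two observables and their affine evolution -/

/-- The excess of a fidelity over that of the maximally mixed state, cut off outside `[1/4, 1]`. -/
noncomputable def excess (F : ℝ) : ℝ := if 1 / 4 ≤ F ∧ F ≤ 1 then F - 1 / 4 else 0

theorem linkExists_zero : linkExists 0 = 0 := by simp [linkExists]

theorem linkExists_of_pos {F : ℝ} (h : 0 < F) : linkExists F = 1 := by simp [linkExists, h]

theorem excess_zero : excess 0 = 0 := if_neg fun h => by norm_num at h

theorem excess_of_mem {F : ℝ} (h1 : 1 / 4 ≤ F) (h2 : F ≤ 1) : excess F = F - 1 / 4 :=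
  if_pos ⟨h1, h2⟩

theorem measurable_linkExists : Measurable linkExists :=
  Measurable.ite (measurableSet_lt measurable_const measurable_id) measurable_const measurable_const

theorem measurable_excess : Measurable excess :=
  Measurable.ite ((measurableSet_le measurable_const measurable_id).inter
    (measurableSet_le measurable_id measurable_const)) (measurable_id.sub_const _) measurable_const

theorem abs_linkExists_le (F : ℝ) : |linkExists F| ≤ 1 := by
  unfold linkExists
  split_ifs <;> simp

/-- The strong law asks for a bound on all of `ℝ`; the cutoff in `excess` supplies it without
changing the values on actual links. -/
theorem abs_excess_le (F : ℝ) : |excess F| ≤ 1 := by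
  unfold excess
  split_ifs with h
  · rw [abs_le]
    constructor <;> linarith [h.1, h.2]
  · simp

variable (S : Buffer)

/-! The conditional expectations of `linkExists` and `excess` after one step are affine in their
values before it, with the following coefficients. -/

noncomputable def linkLink : ℝ := (1 - S.pcon) * (1 - S.q * S.pgenStar + S.q * S.avg S.d)

noncomputable def linkExcess : ℝ := (1 - S.pcon) * (S.q * (S.avg S.c * Real.exp (-S.Γ)))

noncomputable def excessExcess : ℝ :=
  (1 - S.pcon) * (Real.exp (-S.Γ) * (1 - S.q * S.pgenStar + S.q * S.avg S.a))

noncomputable def excessLink : ℝ := (1 - S.pcon) * (S.q * S.avg S.b)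

/-- The denominator of the average consumed fidelity, up to a positive factor. -/
noncomputable def linkWeight : ℝ := 1 - S.excessExcess + S.linkExcess * (S.Fnew - 1 / 4)

/-- The determinant of the linear system satisfied by the limiting averages of `linkExists` and
`excess`. -/
noncomputable def systemDet : ℝ :=
  (1 - S.linkLink) * (1 - S.excessExcess) - S.linkExcess * S.excessLink + S.pgenStar * S.linkWeight

variable {S}

theorem integral_linkExists_step (hS : S.Admissible) {F : ℝ} (hF : IsFidelity F) :
    ∫ x, linkExists (S.step F x) ∂S.inputLaw =
      S.pgenStar * (1 - linkExists F) + S.linkLink * linkExists F + S.linkExcess * excess F := by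
  rcases hF with rfl | ⟨h1, h2⟩
  · rw [integral_step_zero S measurable_linkExists abs_linkExists_le linkExists_zero,
      linkExists_of_pos (by linarith [hS.Fnew_gt]), linkExists_zero, excess_zero]
    ring
  · obtain ⟨hd1, hd2⟩ := decay_mem hS h1 h2
    have havg : S.avg (fun k => S.succProb k (S.decay F) * linkExists (S.jump k (S.decay F))) =
        S.avg S.c * (S.decay F - 1 / 4) + S.avg S.d := by
      rw [← avg_add_mul]
      refine S.avg_congr fun k hk1 hkn => ?_
      rcases (hS.succProb_mem k hk1 hkn _ hd1 hd2).1.eq_or_lt with h0 | h0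
      · rw [← h0, zero_mul]
        exact h0
      · rw [linkExists_of_pos (by linarith [(jump_mem hS hk1 hkn hd1 hd2 h0).1]), mul_one]
        rfl
    rw [integral_step_pos hS h1 h2 measurable_linkExists abs_linkExists_le linkExists_zero, havg,
      linkExists_of_pos (by linarith), linkExists_of_pos (by linarith), excess_of_mem h1 h2]
    simp only [linkLink, linkExcess, decay]
    ring

theorem integral_excess_step (hS : S.Admissible) {F : ℝ} (hF : IsFidelity F) :
    ∫ x, excess (S.step F x) ∂S.inputLaw =
      S.pgenStar * (S.Fnew - 1 / 4) * (1 - linkExists F) + S.excessExcess * excess F +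
        S.excessLink * linkExists F := by
  rcases hF with rfl | ⟨h1, h2⟩
  · rw [integral_step_zero S measurable_excess abs_excess_le excess_zero,
      excess_of_mem hS.Fnew_gt.le hS.Fnew_le, linkExists_zero, excess_zero]
    ring
  · obtain ⟨hd1, hd2⟩ := decay_mem hS h1 h2
    have havg : S.avg (fun k => S.succProb k (S.decay F) * excess (S.jump k (S.decay F))) =
        S.avg S.a * (S.decay F - 1 / 4) + S.avg S.b := by
      rw [← avg_add_mul]
      refine S.avg_congr fun k hk1 hkn => ?_
      rcases (hS.succProb_mem k hk1 hkn _ hd1 hd2).1.eq_or_lt with h0 | h0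
      -- If the protocol cannot succeed, the division-free bounds squeeze its numerator to zero, so
      -- the affine formula survives.
      · obtain ⟨h3, h4⟩ := hS.output_mem k hk1 hkn _ hd1 hd2
        rw [← h0, mul_zero] at h4
        rw [← h0, zero_mul]
        exact h3.antisymm h4
      · obtain ⟨h3, h4⟩ := jump_mem hS hk1 hkn hd1 hd2 h0
        rw [excess_of_mem h3 h4, jump, add_sub_cancel_left]
        exact mul_div_cancel₀ _ h0.ne'
    rw [integral_step_pos hS h1 h2 measurable_excess abs_excess_le excess_zero, havg,
      excess_of_mem hd1 hd2, linkExists_of_pos (by linarith), excess_of_mem h1 h2]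
    simp only [excessExcess, excessLink, decay]
    ring

/-! ### Positivity of the linear system -/

theorem pgenStar_pos (hS : S.Admissible) : 0 < S.pgenStar :=
  sub_pos.2 (pow_lt_one₀ (sub_nonneg.2 S.pgen.2.2) (by linarith [hS.pgen_pos])
    (by have := hS.n_pos; omega))

theorem pgenStar_le_one (S : Buffer) : S.pgenStar ≤ 1 :=
  sub_le_self _ (pow_nonneg (sub_nonneg.2 S.pgen.2.2) _)

/-- These evaluate the affine maps at the extreme links `F = 1/4` (excess `0`) and `F = 1` (excess
`3/4`): a link survives with probability at most `1 - pcon`, the expected new excess is nonnegative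
from `F = 1/4`, and from `F = 1` it is at most `3/4` of the survival probability. -/
theorem coefficient_bounds (hS : S.Admissible) :
    S.linkLink ≤ 1 - S.pcon ∧ S.linkLink + 3 / 4 * S.linkExcess ≤ 1 - S.pcon ∧
    0 ≤ S.excessLink ∧
    S.excessLink + 3 / 4 * S.excessExcess ≤ 3 / 4 * (S.linkLink + 3 / 4 * S.linkExcess) := by
  have hp : (0 : ℝ) ≤ 1 - S.pcon := sub_nonneg.2 S.pcon.2.2
  have hq0 : (0 : ℝ) ≤ S.q := S.q.2.1
  have hq1 : (S.q : ℝ) ≤ 1 := S.q.2.2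
  have he0 := Real.exp_pos (-S.Γ)
  have he1 : Real.exp (-S.Γ) ≤ 1 := Real.exp_le_one_iff.2 (by linarith [hS.Γ_nonneg])
  have hqg : 0 ≤ 1 - S.q * S.pgenStar := by
    nlinarith [pgenStar_pos hS, pgenStar_le_one S]
  have hprob : ∀ s, 0 ≤ s → s ≤ 3 / 4 → S.avg S.c * s + S.avg S.d ≤ S.pgenStar := by
    intro s hs0 hs1
    rw [← avg_add_mul, ← one_mul S.pgenStar, ← avg_const]
    refine S.avg_mono fun k hk1 hkn => ?_
    have := (hS.succProb_mem k hk1 hkn (s + 1 / 4) (by linarith) (by linarith)).2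
    simpa [succProb] using this
  have hout0 : 0 ≤ S.avg S.b := by
    rw [← zero_mul S.pgenStar, ← avg_const]
    refine S.avg_mono fun k hk1 hkn => ?_
    have := (hS.output_mem k hk1 hkn (1 / 4) le_rfl (by norm_num)).1
    simpa using this
  have hout : ∀ s, 0 ≤ s → s ≤ 3 / 4 →
      S.avg S.a * s + S.avg S.b ≤ 3 / 4 * (S.avg S.c * s + S.avg S.d) := by
    intro s hs0 hs1
    have h0 : 3 / 4 * (S.avg S.c * s + S.avg S.d) =
        S.avg (fun k => (S.c k * s + S.d k) * (3 / 4) + (fun _ => 0) k) := by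
      rw [avg_add_mul S (fun k => S.c k * s + S.d k), avg_add_mul, avg_const]
      ring
    rw [h0, ← avg_add_mul]
    refine S.avg_mono fun k hk1 hkn => ?_
    have := (hS.output_mem k hk1 hkn (s + 1 / 4) (by linarith) (by linarith)).2
    simp only [succProb, add_sub_cancel_right] at this
    linarith
  have hd := hprob 0 le_rfl (by norm_num)
  -- `3/4 * exp (-Γ)` is the excess of a perfect link after decay.
  have hcd := hprob (3 / 4 * Real.exp (-S.Γ)) (by positivity) (by linarith)
  have hab := hout (3 / 4 * Real.exp (-S.Γ)) (by positivity) (by linarith)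
  rw [mul_zero, zero_add] at hd
  unfold linkLink linkExcess excessExcess excessLink
  refine ⟨?_, ?_, by positivity, ?_⟩
  · refine mul_le_of_le_one_right hp ?_
    linarith [mul_le_mul_of_nonneg_left hd hq0]
  · rw [mul_left_comm, ← mul_add]
    refine mul_le_of_le_one_right hp ?_
    linarith [mul_le_mul_of_nonneg_left hcd hq0]
  · have key : S.q * S.avg S.b +
        3 / 4 * (Real.exp (-S.Γ) * (1 - S.q * S.pgenStar + S.q * S.avg S.a)) ≤
        3 / 4 * (1 - S.q * S.pgenStar + S.q * S.avg S.d +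
          3 / 4 * (S.q * (S.avg S.c * Real.exp (-S.Γ)))) := by
      linarith [mul_le_mul_of_nonneg_left hab hq0, mul_le_mul_of_nonneg_right he1 hqg]
    linarith [mul_le_mul_of_nonneg_left key hp]

theorem linkWeight_pos (hS : S.Admissible) : 0 < S.linkWeight := by
  obtain ⟨h1, h2, h3, h4⟩ := coefficient_bounds hS
  have hp := hS.pcon_pos
  have hf0 : 0 < S.Fnew - 1 / 4 := by linarith [hS.Fnew_gt]
  have hf1 : S.Fnew - 1 / 4 ≤ 3 / 4 := by linarith [hS.Fnew_le]
  unfold linkWeight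
  have h5 : 0 < 1 - S.excessExcess := by linarith
  rcases le_total 0 S.linkExcess with h | h
  · positivity
  -- For negative `linkExcess` the worst case is `Fnew = 1`; there the weight is at least `1 -
  -- linkLink`, hence at least `pcon`.
  · nlinarith

theorem systemDet_pos (hS : S.Admissible) : 0 < S.systemDet := by
  obtain ⟨h1, h2, h3, h4⟩ := coefficient_bounds hS
  have hp := hS.pcon_pos
  have hw := mul_pos (pgenStar_pos hS) (linkWeight_pos hS)
  have h5 : 0 < 1 - S.excessExcess := by linarith
  have h6 : 0 < 1 - S.linkLink := by linarith
  have h7 : S.linkExcess * S.excessLink ≤ (1 - S.linkLink) * (1 - S.excessExcess) := by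
    rcases le_total 0 S.linkExcess with h | h
    -- The factors `4/3` and `3/4` cancel in the product of these two bounds.
    · have h8 : S.linkExcess ≤ 4 / 3 * (1 - S.linkLink) := by linarith
      have h9 : S.excessLink ≤ 3 / 4 * (1 - S.excessExcess) := by linarith
      calc _ ≤ (4 / 3 * (1 - S.linkLink)) * (3 / 4 * (1 - S.excessExcess)) :=
            mul_le_mul h8 h9 h3 (by positivity)
        _ = _ := by ring
    · exact (mul_nonpos_of_nonpos_of_nonneg h h3).trans (by positivity)
  unfold systemDet
  linarith

/-! ### Matching the closed formula -/

theorem denominator_eq (S : Buffer) :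
    S.yCoef * S.Fnew + S.zCoef = Real.exp S.Γ * S.linkWeight := by
  have he : Real.exp S.Γ * Real.exp (-S.Γ) = 1 := by rw [← Real.exp_add]; simp
  simp only [yCoef, zCoef, linkWeight, excessExcess, linkExcess]
  linear_combination ((1 - S.pcon) * (1 - S.q * S.pgenStar + S.q * S.avg S.a)
    - (1 - S.pcon) * (S.q * S.avg S.c) * (S.Fnew - 1 / 4)) * he

theorem numerator_eq (S : Buffer) :
    S.wCoef * S.Fnew + S.xCoef = (1 - S.linkLink) * (S.Fnew - 1 / 4) + S.excessLink +
      1 / 4 * (Real.exp S.Γ * S.linkWeight) := by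
  rw [← denominator_eq]
  simp only [wCoef, xCoef, yCoef, zCoef, linkLink, excessLink]
  ring

/-! ### From time averages to averages over requests -/

/-- The averages of a telescoping bounded sequence converge to zero. -/
theorem tendsto_telescope_avg {y : ℕ → ℝ} {C : ℝ} (hy : ∀ n, |y n| ≤ C) :
    Tendsto (fun n : ℕ => (∑ t ∈ Finset.range n, (y (t + 1) - y t)) / n) atTop (𝓝 0) := by
  refine squeeze_zero_norm (a := fun n : ℕ => (C + C) / n) (fun n => ?_)
    (tendsto_const_div_atTop_nhds_zero_nat _)
  rw [Finset.sum_range_sub, norm_div, Real.norm_natCast]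
  gcongr
  exact (norm_sub_le _ _).trans (add_le_add (hy _) (hy _))

/-- Averages of an affine expression. -/
theorem tendsto_avg_linear {z u v : ℕ → ℝ} {A B K : ℝ}
    (h : Tendsto (fun n : ℕ => (∑ t ∈ Finset.range n, (z t - (A * u t + B * v t + K))) / n)
      atTop (𝓝 0))
    (hz : Tendsto (fun n : ℕ => (∑ t ∈ Finset.range n, (z t - u t)) / n) atTop (𝓝 0)) :
    Tendsto (fun n : ℕ => (1 - A) * ((∑ t ∈ Finset.range n, u t) / n) -
      B * ((∑ t ∈ Finset.range n, v t) / n)) atTop (𝓝 K) := by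
  have h1 := (h.sub hz).add_const K
  rw [sub_zero, zero_add] at h1
  refine h1.congr' ?_
  filter_upwards [eventually_gt_atTop 0] with n hn
  have hn' : (n : ℝ) ≠ 0 := by positivity
  simp only [Finset.sum_sub_distrib, Finset.sum_add_distrib, ← Finset.mul_sum, Finset.sum_const,
    Finset.card_range, nsmul_eq_mul]
  field_simp
  ring

/-- The sum over the first `m` times that satisfy `p`. -/
theorem sum_nth_eq {p : ℕ → Prop} [DecidablePred p] (hp : {t | p t}.Infinite) (h0 : ¬p 0)
    (ψ : ℕ → ℝ) (m : ℕ) :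
    ∑ j ∈ Finset.range m, ψ (Nat.nth p j) =
      ∑ t ∈ Finset.range (Nat.nth p m - 1), if p (t + 1) then ψ (t + 1) else 0 := by
  have hpos : 1 ≤ Nat.nth p m := by
    have := Nat.nth_mem_of_infinite hp m
    rw [Nat.one_le_iff_ne_zero]
    intro h
    exact h0 (h ▸ this)
  have h1 : ∑ t ∈ Finset.range (Nat.nth p m), (if p t then ψ t else 0) =
      ∑ t ∈ Finset.range (Nat.nth p m - 1), if p (t + 1) then ψ (t + 1) else 0 := by
    -- Time `0` never satisfies `p`; the shift pairs a request at `t + 1` with the state at `t`.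
    conv_lhs => rw [← Nat.sub_add_cancel hpos, Finset.sum_range_succ']
    simp [h0]
  rw [← h1, ← Finset.sum_filter]
  refine Finset.sum_nbij (Nat.nth p) (fun j hj => ?_) (Nat.nth_injective hp).injOn
    (fun t ht => ?_) fun _ _ => rfl
  · rw [Finset.mem_filter, Finset.mem_range]
    exact ⟨Nat.nth_strictMono hp (Finset.mem_range.1 hj), Nat.nth_mem_of_infinite hp j⟩
  · rw [Finset.mem_coe, Finset.mem_filter, Finset.mem_range] at ht
    refine ⟨Nat.count p t, ?_, Nat.nth_count ht.2⟩
    rw [Finset.mem_coe, Finset.mem_range, ← Nat.nth_lt_nth hp, Nat.nth_count ht.2]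
    exact ht.1

theorem fidelityBefore_succ (f₀ : ℝ) (x : ℕ → Input S.n) (t : ℕ) :
    S.fidelityBefore f₀ x (t + 1) =
      if 0 < S.fidelity f₀ x t then S.decay (S.fidelity f₀ x t) else 0 := rfl

theorem linkExists_fidelityBefore (hS : S.Admissible) {f₀ : ℝ} {x : ℕ → Input S.n} {t : ℕ}
    (hF : IsFidelity (S.fidelity f₀ x t)) :
    linkExists (S.fidelityBefore f₀ x (t + 1)) = linkExists (S.fidelity f₀ x t) := by
  rw [fidelityBefore_succ]
  rcases hF with h | ⟨h1, h2⟩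
  · simp [h]
  · rw [if_pos (by linarith), linkExists_of_pos (by linarith [(decay_mem hS h1 h2).1]),
      linkExists_of_pos (by linarith)]

/-- This is why the two observables suffice: the consumed fidelity is a linear combination of them.
-/
theorem linkExists_mul_fidelityBefore (hS : S.Admissible) {f₀ : ℝ} {x : ℕ → Input S.n} {t : ℕ}
    (hF : IsFidelity (S.fidelity f₀ x t)) :
    linkExists (S.fidelityBefore f₀ x (t + 1)) * S.fidelityBefore f₀ x (t + 1) =
      Real.exp (-S.Γ) * excess (S.fidelity f₀ x t) + 1 / 4 * linkExists (S.fidelity f₀ x t) := by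
  rw [linkExists_fidelityBefore hS hF, fidelityBefore_succ]
  rcases hF with h | ⟨h1, h2⟩
  · simp [h, linkExists_zero, excess_zero]
  · rw [if_pos (by linarith), linkExists_of_pos (by linarith), excess_of_mem h1 h2, decay]
    ring

/-- The average consumed fidelity along an input sequence for which the four time averages agree
with their conditional expectations. -/
theorem isAvgConsumedFidelity_of_tendsto (hS : S.Admissible) {f₀ : ℝ} {x : ℕ → Input S.n}
    (hF : ∀ t, IsFidelity (S.fidelity f₀ x t))
    (h1 : Tendsto (fun n : ℕ => (∑ t ∈ Finset.range n, (linkExists (S.fidelity f₀ x (t + 1)) -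
      (S.pgenStar * (1 - linkExists (S.fidelity f₀ x t)) +
        S.linkLink * linkExists (S.fidelity f₀ x t) +
        S.linkExcess * excess (S.fidelity f₀ x t)))) / n) atTop (𝓝 0))
    (h2 : Tendsto (fun n : ℕ => (∑ t ∈ Finset.range n, (excess (S.fidelity f₀ x (t + 1)) -
      (S.pgenStar * (S.Fnew - 1 / 4) * (1 - linkExists (S.fidelity f₀ x t)) +
        S.excessExcess * excess (S.fidelity f₀ x t) +
        S.excessLink * linkExists (S.fidelity f₀ x t)))) / n) atTop (𝓝 0))
    (h3 : Tendsto (fun n : ℕ => (∑ t ∈ Finset.range n, ({y : Input S.n | y.request}.indicator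
      (fun _ => linkExists (S.fidelity f₀ x t)) (x (t + 1)) -
        S.pcon * linkExists (S.fidelity f₀ x t))) / n) atTop (𝓝 0))
    (h4 : Tendsto (fun n : ℕ => (∑ t ∈ Finset.range n, ({y : Input S.n | y.request}.indicator
      (fun _ => excess (S.fidelity f₀ x t)) (x (t + 1)) -
        S.pcon * excess (S.fidelity f₀ x t))) / n) atTop (𝓝 0)) :
    S.IsAvgConsumedFidelity f₀ x
      ((S.wCoef * S.Fnew + S.xCoef) / (S.yCoef * S.Fnew + S.zCoef)) := by
  classical
  set u : ℕ → ℝ := fun t => linkExists (S.fidelity f₀ x t) with hu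
  set v : ℕ → ℝ := fun t => excess (S.fidelity f₀ x t) with hv
  have hD := systemDet_pos hS
  have hW := linkWeight_pos hS
  have hg := pgenStar_pos hS
  have hp := hS.pcon_pos
  -- The generation term `pgenStar * (1 - u)` is split into a constant and a correction to the
  -- coefficient of `u`.
  have e1 := tendsto_avg_linear (z := fun t => u (t + 1)) (u := u) (v := v)
    (A := S.linkLink - S.pgenStar) (B := S.linkExcess) (K := S.pgenStar)
    (h1.congr fun n => by congr 1; exact Finset.sum_congr rfl fun t _ => by ring)
    (tendsto_telescope_avg (C := 1) fun n => abs_linkExists_le _)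
  have e2 := tendsto_avg_linear (z := fun t => v (t + 1)) (u := v) (v := u)
    (A := S.excessExcess) (B := S.excessLink - S.pgenStar * (S.Fnew - 1 / 4))
    (K := S.pgenStar * (S.Fnew - 1 / 4))
    (h2.congr fun n => by congr 1; exact Finset.sum_congr rfl fun t _ => by ring)
    (tendsto_telescope_avg (C := 1) fun n => abs_excess_le _)
  -- Cramer's rule for the system `e1`, `e2`.
  have hU : Tendsto (fun n : ℕ => (∑ t ∈ Finset.range n, u t) / n) atTop
      (𝓝 (S.pgenStar * S.linkWeight / S.systemDet)) := by
    have := ((e1.const_mul (1 - S.excessExcess)).add (e2.const_mul S.linkExcess)).div_const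
      S.systemDet
    have hlim : ((1 - S.excessExcess) * S.pgenStar +
        S.linkExcess * (S.pgenStar * (S.Fnew - 1 / 4))) / S.systemDet =
        S.pgenStar * S.linkWeight / S.systemDet := by
      rw [linkWeight]
      ring
    rw [hlim] at this
    refine this.congr fun n => ?_
    rw [div_eq_iff hD.ne', systemDet, linkWeight]
    ring
  have hV : Tendsto (fun n : ℕ => (∑ t ∈ Finset.range n, v t) / n) atTop
      (𝓝 (S.pgenStar * ((1 - S.linkLink) * (S.Fnew - 1 / 4) + S.excessLink) / S.systemDet)) := by
    have := ((e2.const_mul (1 - S.linkLink + S.pgenStar)).add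
      (e1.const_mul (S.excessLink - S.pgenStar * (S.Fnew - 1 / 4)))).div_const S.systemDet
    have hlim : ((1 - S.linkLink + S.pgenStar) * (S.pgenStar * (S.Fnew - 1 / 4)) +
        (S.excessLink - S.pgenStar * (S.Fnew - 1 / 4)) * S.pgenStar) / S.systemDet =
        S.pgenStar * ((1 - S.linkLink) * (S.Fnew - 1 / 4) + S.excessLink) / S.systemDet := by
      ring
    rw [hlim] at this
    refine this.congr fun n => ?_
    rw [div_eq_iff hD.ne', systemDet, linkWeight]
    ring
  have hreq : ∀ t c, {y : Input S.n | y.request}.indicator (fun _ => c) (x (t + 1)) =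
      if S.RequestAt x (t + 1) then c else (0 : ℝ) := by
    intro t c
    rw [Set.indicator_apply]
    exact if_congr (by simp [RequestAt]) rfl rfl
  simp_rw [hreq] at h3 h4
  set R : ℕ → ℝ := fun n => ∑ t ∈ Finset.range n, if S.RequestAt x (t + 1) then u t else 0 with hR
  set Q : ℕ → ℝ := fun n => ∑ t ∈ Finset.range n, if S.RequestAt x (t + 1) then v t else 0 with hQ
  have hRlim : Tendsto (fun n : ℕ => R n / n) atTop
      (𝓝 (S.pcon * (S.pgenStar * S.linkWeight / S.systemDet))) := by
    have := h3.add (hU.const_mul (S.pcon : ℝ))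
    rw [zero_add] at this
    refine this.congr fun n => ?_
    rw [Finset.sum_sub_distrib, ← Finset.mul_sum]
    ring
  have hQlim : Tendsto (fun n : ℕ => Q n / n) atTop (𝓝 (S.pcon *
      (S.pgenStar * ((1 - S.linkLink) * (S.Fnew - 1 / 4) + S.excessLink) / S.systemDet))) := by
    have := h4.add (hV.const_mul (S.pcon : ℝ))
    rw [zero_add] at this
    refine this.congr fun n => ?_
    rw [Finset.sum_sub_distrib, ← Finset.mul_sum]
    ring
  have hrate : 0 < S.pcon * (S.pgenStar * S.linkWeight / S.systemDet) := by positivity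
  have hRtop : Tendsto R atTop atTop := by
    refine (hRlim.pos_mul_atTop hrate tendsto_natCast_atTop_atTop).congr' ?_
    filter_upwards [eventually_gt_atTop 0] with n hn
    exact div_mul_cancel₀ _ (by positivity)
  -- Served requests have positive density, so requests cannot stop: `R` would be eventually
  -- constant.
  have hinf : {t | S.RequestAt x t}.Infinite := by
    intro hfin
    obtain ⟨M, hM⟩ := hfin.bddAbove
    have hconst : ∀ n, M ≤ n → R M = R n := fun n hn => by
      refine Finset.sum_subset (Finset.range_mono hn) fun t _ ht => if_neg fun hr => ?_
      rw [Finset.mem_range] at ht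
      have : t + 1 ≤ M := hM hr
      omega
    obtain ⟨n, hn, hn'⟩ := ((hRtop.eventually_gt_atTop (R M)).and (eventually_ge_atTop M)).exists
    exact hn.ne (hconst n hn')
  -- `Nat.nth` counts from zero, so the first `m` requests are exactly those at times `t + 1` with
  -- `t < N m`.
  set N : ℕ → ℕ := fun m => Nat.nth (S.RequestAt x) m - 1 with hN
  have h0 : ¬S.RequestAt x 0 := fun h => by simpa using h.1
  have hNtop : Tendsto N atTop atTop :=
    (tendsto_sub_atTop_nat 1).comp (Nat.nth_strictMono hinf).tendsto_atTop
  have hserved : ∀ m, S.servedCount f₀ x m = R (N m) := fun m => by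
    unfold servedCount requestTime
    rw [sum_nth_eq hinf h0 fun t => linkExists (S.fidelityBefore f₀ x t)]
    exact Finset.sum_congr rfl fun t _ => by rw [linkExists_fidelityBefore hS (hF t)]
  have hconsumed : ∀ m, S.consumedSum f₀ x m =
      Real.exp (-S.Γ) * Q (N m) + 1 / 4 * R (N m) := fun m => by
    unfold consumedSum requestTime
    rw [sum_nth_eq hinf h0 fun t =>
      linkExists (S.fidelityBefore f₀ x t) * S.fidelityBefore f₀ x t]
    simp only [hQ, hR, Finset.mul_sum, ← Finset.sum_add_distrib]
    refine Finset.sum_congr rfl fun t _ => ?_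
    rw [linkExists_mul_fidelityBefore hS (hF t)]
    split_ifs <;> simp [hu, hv]
  have hRN : ∀ᶠ m in atTop, 0 < R (N m) := hNtop.eventually (hRtop.eventually_gt_atTop 0)
  refine ⟨hinf, ?_, ?_⟩
  · filter_upwards [hRN] with m hm
    rw [hserved]
    exact hm.ne'
  · have hratio := (((hQlim.div hRlim hrate.ne').const_mul (Real.exp (-S.Γ))).add_const
      (1 / 4)).comp hNtop
    have he : Real.exp S.Γ ≠ 0 := (Real.exp_pos _).ne'
    have hlim : Real.exp (-S.Γ) * (S.pcon *
        (S.pgenStar * ((1 - S.linkLink) * (S.Fnew - 1 / 4) + S.excessLink) / S.systemDet) /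
        (S.pcon * (S.pgenStar * S.linkWeight / S.systemDet))) + 1 / 4 =
        (S.wCoef * S.Fnew + S.xCoef) / (S.yCoef * S.Fnew + S.zCoef) := by
      rw [numerator_eq, denominator_eq, Real.exp_neg]
      have := hp.ne'
      field_simp
    rw [hlim] at hratio
    refine hratio.congr' ?_
    filter_upwards [hRN, hNtop.eventually_gt_atTop 0] with m hm hm0
    have hm0' : (N m : ℝ) ≠ 0 := by positivity
    have hm' := hm.ne'
    simp only [Function.comp, Pi.div_apply]
    rw [hserved, hconsumed]
    field_simp

theorem ae_unif_nonneg (S : Buffer) : ∀ᵐ x ∂S.inputLaw, 0 ≤ Input.unif x := by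
  have h : ∀ᵐ r ∂((volume : Measure ℝ).restrict (Set.Icc 0 1)), 0 ≤ r :=
    (ae_restrict_mem measurableSet_Icc).mono fun r hr => hr.1
  exact Measure.quasiMeasurePreserving_snd.ae (Measure.quasiMeasurePreserving_snd.ae
    (Measure.quasiMeasurePreserving_snd.ae h))

theorem isFidelity_fidelity (hS : S.Admissible) {f₀ : ℝ} (hf₀ : IsFidelity f₀)
    {x : ℕ → Input S.n} (hx : ∀ t, 0 ≤ (x t).unif) (t : ℕ) : IsFidelity (S.fidelity f₀ x t) := by
  induction t with
  | zero => exact hf₀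
  | succ t ih => exact isFidelity_step hS ih (hx _)

end Buffer
end GnB

/-! ### The theorem -/

open GnB GnB.Buffer in
theorem theorem2 (S : GnB.Buffer) (hS : S.Admissible)
    {Ω : Type*} [MeasurableSpace Ω] (μ : Measure Ω) [IsProbabilityMeasure μ]
    (X : ℕ → Ω → GnB.Buffer.Input S.n)
    (hmeas : ∀ t, Measurable (X t))
    (hindep : iIndepFun X μ)
    (hlaw : ∀ t, μ.map (X t) = S.inputLaw)
    (f₀ : ℝ) (hf₀ : f₀ = 0 ∨ (1 / 4 ≤ f₀ ∧ f₀ ≤ 1)) :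
    S.yCoef * S.Fnew + S.zCoef ≠ 0 ∧
    ∀ᵐ ω ∂μ, S.IsAvgConsumedFidelity f₀ (fun t => X t ω)
      ((S.wCoef * S.Fnew + S.xCoef) / (S.yCoef * S.Fnew + S.zCoef)) := by
  refine ⟨?_, ?_⟩
  · rw [denominator_eq]
    exact (mul_pos (Real.exp_pos _) (linkWeight_pos hS)).ne'
  have hunif : ∀ᵐ ω ∂μ, ∀ t, 0 ≤ (X t ω).unif := by
    refine ae_all_iff.2 fun t => ?_
    have := S.ae_unif_nonneg
    rw [← hlaw t] at this
    exact ae_of_ae_map (hmeas t).aemeasurable this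
  have lln : ∀ {g : ℝ × Input S.n → ℝ}, Measurable g → (∀ z, |g z| ≤ 1) → ∀ᵐ ω ∂μ,
      Tendsto (fun n : ℕ => (∑ t ∈ Finset.range n,
        (g (S.fidelity f₀ (fun t => X t ω) t, X (t + 1) ω) -
          ∫ y, g (S.fidelity f₀ (fun t => X t ω) t, y) ∂S.inputLaw)) / n) atTop (𝓝 0) :=
    fun hg hC => ae_tendsto_avg_sub_integral hmeas hindep hlaw
      (Z := fun t ω => S.fidelity f₀ (fun t => X t ω) t) S.measurable_step f₀ (fun _ => rfl)
      (fun _ _ => rfl) hg hC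
  have hind : ∀ {φ : ℝ → ℝ}, Measurable φ →
      Measurable fun z : ℝ × Input S.n => {y : Input S.n | y.request}.indicator
        (fun _ => φ z.1) z.2 := by
    intro φ hφ
    exact (hφ.comp measurable_fst).indicator (measurable_snd measurableSet_request)
  have hindC : ∀ {φ : ℝ → ℝ}, (∀ F, |φ F| ≤ 1) → ∀ z : ℝ × Input S.n,
      |{y : Input S.n | y.request}.indicator (fun _ => φ z.1) z.2| ≤ 1 := by
    intro φ hφ z
    by_cases hz : z.2 ∈ {y : Input S.n | y.request}
    · simpa [hz] using hφ z.1
    · simp [hz]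
  -- Four uses of the strong law: each observable after a step, and each current observable
  -- restricted to requests.
  filter_upwards [hunif, lln (measurable_linkExists.comp S.measurable_step)
      fun z => abs_linkExists_le _, lln (measurable_excess.comp S.measurable_step)
      fun z => abs_excess_le _, lln (hind measurable_linkExists) (hindC abs_linkExists_le),
      lln (hind measurable_excess) (hindC abs_excess_le)] with ω hω h1 h2 h3 h4
  have hF := isFidelity_fidelity (x := fun t => X t ω) hS hf₀ hω
  simp only [integral_request] at h3 h4
  refine isAvgConsumedFidelity_of_tendsto hS hF ?_ ?_ h3 h4
  · refine h1.congr fun n => ?_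
    congr 1
    refine Finset.sum_congr rfl fun t _ => ?_
    rw [← integral_linkExists_step hS (hF t)]
    rfl
  · refine h2.congr fun n => ?_
    congr 1
    refine Finset.sum_congr rfl fun t _ => ?_
    rw [← integral_excess_step hS (hF t)]
    rfl
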